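/- Let $M$ be a compact connected smooth Riemannian manifold (without boundary), equipped with its geodesic metric $d$, i.e. $d(x,y)$ is the infimum of the lengths of the $C^1$ paths from $x$ to $y$. For an integer $k\ge 0$, a regular simplex with $k$ vertices in $M$ is a $k$-tuple $(v_1,\dots,v_k)$ of points of $M$ for which there is an $\ell>0$ such that $d(v_i,v_j)=\ell$ for all $i\neq j$. Then there is a natural number $N$, depending only on $M$ and its metric, such that every regular simplex in $M$ has at most $N$ vertices. -/

import Mathlib

open Bundle
open scoped Manifold ContDiff

/-- A regular simplex with `k` vertices in a metric space: a `k`-tuple of points any two of which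
(at different indices) are at one and the same distance `ℓ`. Positivity of `ℓ` says that the
vertices are pairwise distinct. -/
def IsRegularSimplex {X : Type*} [MetricSpace X] {k : ℕ} (v : Fin k → X) : Prop :=
  ∃ ℓ : ℝ, 0 < ℓ ∧ ∀ i j : Fin k, i ≠ j → dist (v i) (v j) = ℓ

/-!
A regular simplex of side `ℓ` is an `ℓ`-separated set lying in a closed ball of radius `ℓ`, so a
bound on its number of vertices follows from a doubling property of the metric. Simplices whose
side is bounded below are handled by compactness of `M` alone. Near a point of `M`, the chart is
bi-Lipschitz from the geodesic distance to the Euclidean distance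
(`exists_nhds_edist_le_mul_edist_extChartAt` and `exists_nhds_edist_extChartAt_le_mul_edist`), so a
small simplex, read in the chart and rescaled to side `1`, is a separated set in a ball of
`EuclideanSpace ℝ (Fin n)` with constants independent of `ℓ`
(`IsRegularSimplex.exists_card_le_of_bilipschitz`). A Lebesgue number of the cover by these
neighborhoods separates the two cases (`exists_card_le_of_locally`).
-/

section Chart

open Set MeasureTheory Manifold Filter
open scoped ENNReal NNReal Topology

-- The operator norms of `mfderiv (extChartAt I x)` and of its inverse refer to the norm of `E` on
-- the tangent spaces of the model space.
attribute [local instance] normedAddCommGroupTangentSpaceVectorSpace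
attribute [local instance] normedSpaceTangentSpaceVectorSpace

variable {E : Type*} [NormedAddCommGroup E] [NormedSpace ℝ E]
  {H : Type*} [TopologicalSpace H] (I : ModelWithCorners ℝ E H)
  {M : Type*} [PseudoEMetricSpace M] [ChartedSpace H M]
  [RiemannianBundle (fun x : M ↦ TangentSpace I x)]
  [IsManifold I 1 M] [IsContinuousRiemannianBundle E (fun x : M ↦ TangentSpace I x)]
  [IsRiemannianManifold I M]

/-- Near `x` the inverse of the chart is Lipschitz: the segment between two points in the chart is
pushed to a path in `M` whose length is controlled by the derivative of the inverse chart.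
Both points vary; `eventually_riemannianEDist_le_edist_extChartAt` is the case where one of them
is `x`. -/
theorem exists_nhds_edist_le_mul_edist_extChartAt (x : M) :
    ∃ C : ℝ≥0, ∃ s ∈ 𝓝 x, ∀ y ∈ s, ∀ z ∈ s,
      edist y z ≤ C * edist (extChartAt I x y) (extChartAt I x z) := by
  rcases eventually_enorm_mfderivWithin_symm_extChartAt_lt I x with ⟨C, -, hC⟩
  obtain ⟨r, r_pos, hr⟩ := Metric.nhdsWithin_basis_ball.eventually_iff.1
    (hC.and (extChartAt_target_mem_nhdsWithin x))
  have A : (extChartAt I x) ⁻¹' (Metric.ball (extChartAt I x x) r ∩ range I) ∈ 𝓝 x := by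
    apply extChartAt_preimage_mem_nhds_of_mem_nhdsWithin (by simp)
    rw [inter_comm]
    exact inter_mem_nhdsWithin _ (Metric.ball_mem_nhds _ r_pos)
  refine ⟨C, _, inter_mem A (chart_source_mem_nhds H x), ?_⟩
  rintro y ⟨hy, h'y⟩ z ⟨hz, h'z⟩
  let η := ContinuousAffineMap.lineMap (R := ℝ) (extChartAt I x y) (extChartAt I x z)
  set γ := (extChartAt I x).symm ∘ η
  have hη : Icc 0 1 ⊆ ⇑η ⁻¹' (Metric.ball (extChartAt I x x) r ∩ range I) := by
    simp only [← image_subset_iff, ContinuousAffineMap.coe_lineMap_eq,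
     ← segment_eq_image_lineMap, η]
    exact ((convex_ball _ _).inter I.convex_range).segment_subset hy hz
  have hη_target : Icc 0 1 ⊆ ⇑η ⁻¹' (extChartAt I x).target := fun t ht ↦ (hr (hη ht)).2
  have η_smooth : CMDiff[Icc 0 1] 1 η := by
    apply ContMDiff.contMDiffOn
    rw [contMDiff_iff_contDiff]
    exact ContinuousAffineMap.contDiff _
  have : edist y z ≤ pathELength I γ 0 1 := by
    rw [IsRiemannianManifold.out (I := I) y z]
    apply riemannianEDist_le_pathELength _ _ _ zero_le_one
    · exact (contMDiffOn_extChartAt_symm x).comp η_smooth hη_target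
    · simp [γ, η, ContinuousAffineMap.coe_lineMap_eq, h'y]
    · simp [γ, η, ContinuousAffineMap.coe_lineMap_eq, h'z]
  apply this.trans
  rw [← lintegral_fderiv_lineMap_eq_edist, pathELength_eq_lintegral_mfderivWithin_Icc,
    ← lintegral_const_mul' _ _ ENNReal.coe_ne_top]
  apply setLIntegral_mono' measurableSet_Icc (fun t ht ↦ ?_)
  have : mfderiv[Icc 0 1] γ t =
      (mfderiv[range I] (extChartAt I x).symm (η t)) ∘L (mfderiv[Icc 0 1] η t) := by
    apply mfderivWithin_comp
    · exact mdifferentiableWithinAt_extChartAt_symm (hη_target ht)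
    · exact η_smooth.mdifferentiableOn one_ne_zero t ht
    · exact hη_target.trans (preimage_mono (extChartAt_target_subset_range x))
    · rw [uniqueMDiffWithinAt_iff_uniqueDiffWithinAt]
      exact uniqueDiffOn_Icc zero_lt_one t ht
  have : mfderiv[Icc 0 1] γ t 1 =
      (mfderiv[range I] (extChartAt I x).symm (η t)) (mfderiv[Icc 0 1] η t 1) := congr($this 1)
  rw [this]
  apply (ContinuousLinearMap.le_opENorm _ _).trans
  gcongr
  · exact (hr (hη ht)).1.le
  · simp only [mfderivWithin_eq_fderivWithin]
    exact le_of_eq rfl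

/-- Near `x` the chart is Lipschitz: two points in a small ball are joined by almost shortest
paths, which remain in a ball on which the derivative of the chart is bounded. -/
theorem exists_nhds_edist_extChartAt_le_mul_edist (x : M) :
    ∃ C : ℝ≥0, ∃ s ∈ 𝓝 x, ∀ y ∈ s, ∀ z ∈ s,
      edist (extChartAt I x y) (extChartAt I x z) ≤ C * edist y z := by
  rcases eventually_enorm_mfderiv_extChartAt_lt I x with ⟨C, C_pos, hC⟩
  obtain ⟨r, r_pos, hr⟩ := Metric.nhds_basis_eball.eventually_iff.1
    (hC.and (chart_source_mem_nhds H x))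
  have r3 : 0 < r / 3 := ENNReal.div_pos r_pos.ne' (by simp)
  -- For `y` and `z` at distance less than `r / 3` from `x`, a path from `y` to `z` of length less
  -- than `2 * r / 3` stays at distance less than `r` from `x`.
  refine ⟨C, Metric.eball x (r / 3), Metric.eball_mem_nhds x r3, fun y hy z hz ↦ ?_⟩
  have hyz : edist y z < r / 3 + r / 3 :=
    (edist_triangle_right y z x).trans_lt (ENNReal.add_lt_add hy hz)
  -- Taking the infimum over `L`, it suffices to consider path lengths `L > edist y z` that are
  -- at most `2 * r / 3`.
  suffices H : ∀ L, edist y z < L → L ≤ r / 3 + r / 3 →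
      edist (extChartAt I x y) (extChartAt I x z) ≤ C * L by
    rw [mul_comm, ← ENNReal.div_le_iff_le_mul (by simp [C_pos.ne']) (by simp)]
    refine le_of_forall_gt_imp_ge_of_dense fun L hL ↦ ?_
    rw [ENNReal.div_le_iff_le_mul (by simp [C_pos.ne']) (by simp), mul_comm]
    rcases le_total L (r / 3 + r / 3) with h | h
    · exact H L hL h
    · exact (H _ hyz le_rfl).trans (by gcongr)
  intro L hL hLr
  rw [IsRiemannianManifold.out (I := I) y z] at hL
  obtain ⟨γ, hγy, hγz, γ_smooth, hγ⟩ := exists_lt_of_riemannianEDist_lt hL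
  have γ_mem : ∀ t ∈ Icc (0 : ℝ) 1, γ t ∈ Metric.eball x r := by
    intro t ht
    have h1 : edist (γ t) y < r / 3 + r / 3 := by
      rw [edist_comm, IsRiemannianManifold.out (I := I) y (γ t)]
      refine (riemannianEDist_le_pathELength (γ_smooth.mono (Icc_subset_Icc_right ht.2)) hγy rfl
        ht.1).trans_lt (((pathELength_mono le_rfl ht.2).trans_lt hγ).trans_le hLr)
    calc edist (γ t) x ≤ edist (γ t) y + edist y x := edist_triangle _ _ _
      _ < (r / 3 + r / 3) + r / 3 := ENNReal.add_lt_add h1 hy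
      _ = r := ENNReal.add_thirds r
  let γ' := extChartAt I x ∘ γ
  have hγ' : CMDiff[Icc 0 1] 1 γ' :=
    contMDiffOn_extChartAt.comp (I' := I) (t := (chartAt H x).source)
      γ_smooth (fun t ht ↦ (hr (γ_mem t ht)).2)
  calc
      edist (extChartAt I x y) (extChartAt I x z)
    _ = ‖γ' 1 - γ' 0‖ₑ := by rw [edist_comm, edist_eq_enorm_sub]; simp [γ', hγy, hγz]
    _ ≤ ∫⁻ t in Icc 0 1, ‖derivWithin γ' (Icc 0 1) t‖ₑ := by
      apply enorm_sub_le_lintegral_derivWithin_Icc_of_contDiffOn_Icc _ zero_le_one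
      rwa [← contMDiffOn_iff_contDiffOn]
    _ = ∫⁻ t in Icc 0 1, ‖mfderiv[Icc 0 1] γ' t 1‖ₑ := by
      simp_rw [← fderivWithin_derivWithin, mfderivWithin_eq_fderivWithin]
      rfl
    _ ≤ ∫⁻ t in Icc 0 1, C * ‖mfderiv[Icc 0 1] γ t 1‖ₑ := by
      apply setLIntegral_mono' measurableSet_Icc (fun t ht ↦ ?_)
      have : mfderiv[Icc 0 1] γ' t =
          (mfderiv% (extChartAt I x) (γ t)) ∘L (mfderiv[Icc 0 1] γ t) := by
        apply mfderiv_comp_mfderivWithin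
        · exact mdifferentiableAt_extChartAt ((hr (γ_mem t ht)).2)
        · exact γ_smooth.mdifferentiableOn one_ne_zero _ ht
        · rw [uniqueMDiffWithinAt_iff_uniqueDiffWithinAt]
          exact uniqueDiffOn_Icc zero_lt_one _ ht
      have : mfderiv[Icc 0 1] γ' t 1 =
          (mfderiv% (extChartAt I x) (γ t)) (mfderiv[Icc 0 1] γ t 1) :=
        congr($this 1)
      rw [this]
      apply (ContinuousLinearMap.le_opENorm _ _).trans
      gcongr
      exact (hr (γ_mem t ht)).1.le
    _ = C * pathELength I γ 0 1 := by
      rw [lintegral_const_mul' _ _ ENNReal.coe_ne_top,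
          pathELength_eq_lintegral_mfderivWithin_Icc]
    _ ≤ C * L := by gcongr

end Chart

section Packing

open Set Filter
open scoped Topology

theorem IsCompact.exists_card_le_of_pairwise_le_dist {X : Type*} [PseudoMetricSpace X] {K : Set X}
    (hK : IsCompact K) {ε : ℝ} (hε : 0 < ε) :
    ∃ N : ℕ, ∀ (k : ℕ) (v : Fin k → X), (∀ i, v i ∈ K) →
      (∀ i j, i ≠ j → ε ≤ dist (v i) (v j)) → k ≤ N := by
  obtain ⟨t, -, ht, hKt⟩ := hK.finite_cover_balls (half_pos hε)
  refine ⟨ht.toFinset.card, fun k v hv hsep ↦ ?_⟩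
  have hc : ∀ i, ∃ c ∈ t, v i ∈ Metric.ball c (ε / 2) := fun i ↦ by simpa using hKt (hv i)
  choose c hct hc using hc
  have hinj : Function.Injective c := by
    intro i j hij
    by_contra hne
    have h1 := hsep i j hne
    have h2 := dist_triangle_right (v i) (v j) (c i)
    have h3 := Metric.mem_ball.1 (hc i)
    have h4 := Metric.mem_ball.1 (hc j)
    rw [← hij] at h4
    linarith
  simpa using Finset.card_le_card_of_injOn (s := Finset.univ) c (by simpa using hct) hinj.injOn

/-- The image of a regular simplex of side `ℓ` under a bi-Lipschitz map to a finite-dimensional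
space, translated so that the first vertex goes to `0` and rescaled by `ℓ⁻¹`, is a separated subset
of a ball, where the separation and the radius do not depend on `ℓ`. -/
theorem IsRegularSimplex.exists_card_le_of_bilipschitz {X F : Type*} [MetricSpace X]
    [NormedAddCommGroup F] [NormedSpace ℝ F] [FiniteDimensional ℝ F] {s : Set X} (f : X → F)
    {C D : ℝ} (hC : ∀ y ∈ s, ∀ z ∈ s, dist y z ≤ C * dist (f y) (f z))
    (hD : ∀ y ∈ s, ∀ z ∈ s, dist (f y) (f z) ≤ D * dist y z) :
    ∃ N : ℕ, ∀ (k : ℕ) (v : Fin k → X), IsRegularSimplex v → (∀ i, v i ∈ s) → k ≤ N := by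
  obtain ⟨N, hN⟩ := (ProperSpace.of_locallyCompactSpace ℝ (E := F)).isCompact_closedBall (0 : F)
    (max D 0) |>.exists_card_le_of_pairwise_le_dist (ε := (max C 1)⁻¹) (by positivity)
  refine ⟨N, fun k v ⟨ℓ, hℓ, hv⟩ hs ↦ ?_⟩
  rcases k with _ | k
  · exact N.zero_le
  refine hN _ (fun i ↦ ℓ⁻¹ • (f (v i) - f (v 0))) (fun i ↦ ?_) fun i j hij ↦ ?_
  · rw [mem_closedBall_zero_iff, norm_smul, ← dist_eq_norm, Real.norm_of_nonneg (by positivity),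
      inv_mul_le_iff₀ hℓ]
    rcases eq_or_ne i 0 with rfl | hi
    · rw [dist_self]; positivity
    · refine (hD _ (hs i) _ (hs 0)).trans ?_
      rw [hv i 0 hi, mul_comm]
      gcongr
      exact le_max_left _ _
  · have h := hC _ (hs i) _ (hs j)
    rw [hv i j hij] at h
    rw [dist_smul₀, dist_sub_right, Real.norm_of_nonneg (by positivity), le_inv_mul_iff₀ hℓ,
      ← div_eq_mul_inv, div_le_iff₀' (by positivity)]
    exact h.trans (by gcongr; exact le_max_left _ _)

/-- On a compact space, a bound on the number of vertices near each point gives a global bound: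
simplices whose side is below a Lebesgue number of the cover are subject to one of finitely many
local bounds, and those with longer side form a separated set. -/
theorem exists_card_le_of_locally {X : Type*} [MetricSpace X] [CompactSpace X]
    (h : ∀ x : X, ∃ s ∈ 𝓝 x, ∃ N : ℕ,
      ∀ (k : ℕ) (v : Fin k → X), IsRegularSimplex v → (∀ i, v i ∈ s) → k ≤ N) :
    ∃ N : ℕ, ∀ (k : ℕ) (v : Fin k → X), IsRegularSimplex v → k ≤ N := by
  choose s hs b hb using h
  obtain ⟨t, ht⟩ := isCompact_univ.elim_nhds_subcover (fun x ↦ interior (s x))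
    fun x _ ↦ interior_mem_nhds.2 (hs x)
  obtain ⟨δ, hδ, hball⟩ := lebesgue_number_lemma_of_metric (isCompact_univ (X := X))
    (c := fun x : t ↦ interior (s x)) (fun _ ↦ isOpen_interior)
    (by simpa [iUnion_subtype] using ht)
  obtain ⟨N, hN⟩ := (isCompact_univ (X := X)).exists_card_le_of_pairwise_le_dist hδ
  refine ⟨max N (t.sup b), fun k v hv ↦ ?_⟩
  obtain ⟨ℓ, hℓ, hvℓ⟩ := id hv
  rcases k with _ | k
  · exact Nat.zero_le _
  rcases le_or_gt δ ℓ with hδℓ | hδℓ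
  · exact le_max_of_le_left (hN _ v (fun _ ↦ mem_univ _)
      fun i j hij ↦ hδℓ.trans_eq (hvℓ i j hij).symm)
  · obtain ⟨x, hx⟩ := hball (v 0) (mem_univ _)
    refine le_max_of_le_right ((hb x _ v hv fun i ↦ interior_subset (hx ?_)).trans
      (Finset.le_sup x.2))
    rcases eq_or_ne i 0 with rfl | hi
    · exact Metric.mem_ball_self hδ
    · rwa [Metric.mem_ball, hvℓ i 0 hi]

end Packing

theorem mainTheorem3 (n : ℕ) (M : Type*) [MetricSpace M]
    [ChartedSpace (EuclideanSpace ℝ (Fin n)) M] [IsManifold (𝓡 n) ∞ M]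
    [RiemannianBundle (fun x : M => TangentSpace (𝓡 n) x)]
    [IsContMDiffRiemannianBundle (𝓡 n) ∞ (EuclideanSpace ℝ (Fin n))
      (fun x : M => TangentSpace (𝓡 n) x)]
    [IsRiemannianManifold (𝓡 n) M] [CompactSpace M] [ConnectedSpace M] :
    ∃ N : ℕ, ∀ (k : ℕ) (v : Fin k → M), IsRegularSimplex v → k ≤ N := by
  have : IsContinuousRiemannianBundle (EuclideanSpace ℝ (Fin n))
      (fun x : M => TangentSpace (𝓡 n) x) := by
    obtain ⟨g, hg, hinner⟩ := IsContMDiffRiemannianBundle.exists_contMDiff (IB := 𝓡 n) (n := ∞)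
      (F := EuclideanSpace ℝ (Fin n)) (E := fun x : M => TangentSpace (𝓡 n) x)
    exact ⟨g, hg.continuous, hinner⟩
  refine exists_card_le_of_locally fun x ↦ ?_
  obtain ⟨C, s, hs, hC⟩ := exists_nhds_edist_le_mul_edist_extChartAt (𝓡 n) x
  obtain ⟨D, t, ht, hD⟩ := exists_nhds_edist_extChartAt_le_mul_edist (𝓡 n) x
  refine ⟨s ∩ t, Filter.inter_mem hs ht,
    IsRegularSimplex.exists_card_le_of_bilipschitz (extChartAt (𝓡 n) x)
      (C := C) (D := D) (fun y hy z hz ↦ ?_) fun y hy z hz ↦ ?_⟩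
  · have h := hC y hy.1 z hz.1
    rw [edist_nndist, edist_nndist, ← ENNReal.coe_mul, ENNReal.coe_le_coe] at h
    exact_mod_cast h
  · have h := hD y hy.2 z hz.2
    rw [edist_nndist, edist_nndist, ← ENNReal.coe_mul, ENNReal.coe_le_coe] at h
    exact_mod_cast h
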